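/- There exist a probability space $(\Omega,\mathcal K,P)$ (with $\Omega$ standard Borel), two commuting, invertible, bimeasurable, measure preserving and ergodic transformations $T,S:\Omega\to\Omega$, a sub-$\sigma$-field $\mathcal F_{0,0}\subset\mathcal K$ and an $\mathcal F_{0,0}$-measurable, square integrable function $X_{0,0}:\Omega\to\mathbb R$ such that, with $$\mathcal F_{i,j}=T^{-i}S^{-j}(\mathcal F_{0,0}),\qquad X_{i,j}=X_{0,0}\circ T^iS^j\quad(i,j\in\mathbb Z),\qquad S_{n,v}=\sum_{i=0}^{n-1}\sum_{j=0}^{v-1}X_{i,j}\quad(n,v\ge 1),$$ the following hold. (a) $\mathcal F_{0,0}\subset\mathcal F_{0,1}$ and $\mathcal F_{0,0}\subset\mathcal F_{1,0}$, and the filtration is commuting: for every integrable $Y$ and all $a,b,u,v\in\mathbb Z$, $E\big(E(Y\mid\mathcal F_{a,b})\mid\mathcal F_{u,v}\big)=E(Y\mid\mathcal F_{a\wedge u,\,b\wedge v})$ almost surely. (b) $(X_{i,j})$ is an orthomartingale difference field: $E(X_{i,j}\mid\mathcal F_{u,v})=0$ almost surely whenever $u<i$ or $v<j$. (c) $E\big(X_{0,0}^2\ln(1+|X_{0,0}|)\big)=\infty$,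 but $E\big(X_{0,0}^2\ln^{1-\varepsilon}(1+|X_{0,0}|)\big)<\infty$ for every $0<\varepsilon<1$. (d) The quenched central limit theorem over rectangles fails: writing $P^\omega$ for a regular conditional probability $P(\cdot\mid\mathcal F_{0,0})(\omega)$ and $\sigma^2=E(X_{0,0}^2)$, it is not true that for $P$-almost every $\omega$, $$\frac{S_{n,v}}{\sqrt{nv}}\Rightarrow N(0,\sigma^2)\ \text{ under } P^\omega\quad\text{as } n\wedge v\to\infty .$$ -/

import Mathlib

open MeasureTheory ProbabilityTheory Filter

noncomputable section

/-- The map `T^i ∘ S^j` for `(i, j) ∈ ℤ²`; the powers are taken in the group of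
permutations of `Ω`. -/
def shiftMap {Ω : Type*} (T S : Equiv.Perm Ω) (i j : ℤ) : Ω → Ω :=
  fun ω => (T ^ i) ((S ^ j) ω)

/-- The σ-field `F_{i,j} = T^{-i} S^{-j} (F_{0,0})`, that is, the collection of the preimages
under `T^i ∘ S^j` of the members of `F_{0,0}`. -/
abbrev shiftFiltration {Ω : Type*} (T S : Equiv.Perm Ω) (F₀ : MeasurableSpace Ω)
    (i j : ℤ) : MeasurableSpace Ω :=
  MeasurableSpace.comap (shiftMap T S i j) F₀

/-- The field `X_{i,j} = X_{0,0} ∘ T^i ∘ S^j`. -/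
def shiftField {Ω : Type*} (T S : Equiv.Perm Ω) (X₀ : Ω → ℝ) (i j : ℤ) : Ω → ℝ :=
  fun ω => X₀ (shiftMap T S i j ω)

/-- The filtration is commuting: `E_{u,v} E_{a,b} Y = E_{a ∧ u, b ∧ v} Y` almost surely, for every
integrable `Y`. -/
def IsCommutingFiltration {Ω : Type*} {mΩ : MeasurableSpace Ω} (P : Measure Ω)
    (F : ℤ → ℤ → MeasurableSpace Ω) : Prop :=
  ∀ Y : Ω → ℝ, Integrable Y P → ∀ a b u v : ℤ,
    P[P[Y | F a b] | F u v] =ᵐ[P] P[Y | F (min a u) (min b v)]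

/-- The orthomartingale difference property: `E(X_{i,j} | F_{u,v}) = 0` almost surely if either
`u < i` or `v < j`. -/
def IsOrthomartingaleDifference {Ω : Type*} {mΩ : MeasurableSpace Ω} (P : Measure Ω)
    (F : ℤ → ℤ → MeasurableSpace Ω) (X : ℤ → ℤ → Ω → ℝ) : Prop :=
  ∀ i j u v : ℤ, (u < i ∨ v < j) → P[X i j | F u v] =ᵐ[P] 0

/-- The partial sums over rectangles, `S_{n,v} = ∑_{i=0}^{n-1} ∑_{j=0}^{v-1} X_{i,j}`. -/
def rectSum {Ω : Type*} (X : ℤ → ℤ → Ω → ℝ) (n v : ℕ) (ω : Ω) : ℝ :=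
  ∑ i ∈ Finset.range n, ∑ j ∈ Finset.range v, X (i : ℤ) (j : ℤ) ω

/-- The regular conditional probability `P^ω = P(· | F₀)(ω)`. -/
def quenchedMeasure {Ω : Type*} (F₀ : MeasurableSpace Ω) {mΩ : MeasurableSpace Ω}
    [StandardBorelSpace Ω] (P : Measure Ω) [IsProbabilityMeasure P] (ω : Ω) : Measure Ω :=
  condExpKernel P F₀ ω

instance quenchedMeasure_isProbabilityMeasure {Ω : Type*} (F₀ : MeasurableSpace Ω)
    {mΩ : MeasurableSpace Ω} [StandardBorelSpace Ω] (P : Measure Ω) [IsProbabilityMeasure P]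
    (ω : Ω) : IsProbabilityMeasure (quenchedMeasure F₀ P ω) :=
  (inferInstance : @IsMarkovKernel Ω Ω F₀ mΩ (condExpKernel P F₀)).isProbabilityMeasure ω

/-- The quenched central limit theorem over unrestricted rectangles: for `P`-almost every `ω`,
`S_{n,v} / √(n v)` converges in distribution to `N(0, E X_{0,0}²)` under the regular conditional
probability `P^ω = P(· | F₀)(ω)`, when `n ∧ v → ∞` (which is `atTop` on `ℕ × ℕ`). -/
def QuenchedCLT {Ω : Type*} (F₀ : MeasurableSpace Ω) {mΩ : MeasurableSpace Ω}
    [StandardBorelSpace Ω] (P : Measure Ω) [IsProbabilityMeasure P] (X : ℤ → ℤ → Ω → ℝ) : Prop :=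
  ∀ᵐ ω ∂P,
    TendstoInDistribution
      (fun (p : ℕ × ℕ) (ω' : Ω) => rectSum X p.1 p.2 ω' / √((p.1 : ℝ) * (p.2 : ℝ)))
      atTop (id : ℝ → ℝ) (fun _ => quenchedMeasure F₀ P ω)
      (gaussianReal 0 (∫ ω', (X 0 0 ω') ^ 2 ∂P).toNNReal)

end

/-!
The counterexample is `X_{i,j} = ξ_{i,j} g_{i,j}`, where the `ξ_{i,j}` are fair signs, the
`g_{i,j}` are positive, all of these variables are independent, and `F_{i,j}` is generated by the
signs `ξ_{a,b}` with `a ≤ i`, `b ≤ j` together with *all* the sizes `g`. The probability space is a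
countable product with a shift-invariant product law, so that the coordinate shifts are ergodic
(`ergodic_comp_infinitePi`). Each `F_{i,j}` is generated by a set of coordinates; conditioning on
such a σ-field means integrating the other coordinates out, hence conditional expectations commute
and compose to the one for the intersection of the two sets (`condExp_condExp_cylinderEvents`).
The orthomartingale property is the symmetry of a sign that is not yet known.

The size is `√(2 ^ k)` with a probability proportional to `2⁻ᵏ (k + 1)⁻²`. Its square is integrable
against `log ^ (1 - ε)` but not against `log`, as `∑ (k + 1) ^ (-1 - ε)` converges and `∑ 1 / k`
does not. The logarithm is the one that appears when the tails are summed over the lattice: for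
every constant `c` the series `∑ P (g² ≥ c i j)` diverges over each quadrant
(`tsum_sizeLaw_tail_eq_top`). By the second Borel–Cantelli lemma, almost surely
`g_{n-1,v-1} ≥ √(c n v)` for pairs `(n, v)` with `n ∧ v` arbitrarily large
(`ae_exists_exceptional_size`). Since `F_{0,0}` knows the sizes, these pairs are fixed under the
conditional law `P^ω`, under which the sign at `(n - 1, v - 1)` is still a fair coin. Changing it
changes `S_{n,v}` by `2 g_{n-1,v-1}`, so `|S_{n,v}| ≥ √(c n v)` with conditional probability at
least `1/2` (`half_le_quenchedMeasure_rectSum`). For `c` large the normal law gives less than `1/2`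
to the closed set `{|t| ≥ √c}`, which contradicts the portmanteau theorem.
-/

/-! ### Cylinder σ-fields of a product measure -/

section Cylinder

variable {ι : Type*} {E : ι → Type*} [∀ i, MeasurableSpace (E i)]

theorem cylinderEvents_le_comap_restrict (A : Set ι) :
    cylinderEvents (X := E) A ≤ MeasurableSpace.comap A.domRestrict MeasurableSpace.pi := by
  refine iSup₂_le fun i hi => ?_
  rintro s ⟨t, ht, rfl⟩
  exact ⟨(fun g : ∀ i : A, E i => g ⟨i, hi⟩) ⁻¹' t, measurable_pi_apply _ ht, rfl⟩

/-- Membership in an event of `cylinderEvents A` depends on the coordinates in `A` only. -/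
theorem mem_iff_of_eqOn_of_measurableSet_cylinderEvents {A : Set ι} {D : Set (∀ i, E i)}
    (hD : MeasurableSet[cylinderEvents A] D) {x y : ∀ i, E i} (hxy : ∀ i ∈ A, x i = y i) :
    x ∈ D ↔ y ∈ D := by
  obtain ⟨t, -, rfl⟩ := cylinderEvents_le_comap_restrict A D hD
  have : A.domRestrict x = A.domRestrict y := funext fun i => hxy i i.2
  simp only [Set.mem_preimage, this]

variable (μ : ∀ i, Measure (E i)) [∀ i, IsProbabilityMeasure (μ i)]
  (A B : Set ι) [∀ i, Decidable (i ∈ A)]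

theorem measurable_piecewise_prod :
    Measurable fun p : (∀ i, E i) × (∀ i, E i) => A.piecewise p.1 p.2 := by
  refine measurable_pi_iff.2 fun i => ?_
  by_cases hi : i ∈ A <;> simp only [Set.piecewise, hi, if_true, if_false] <;> fun_prop

theorem measurable_piecewise_prod_cylinderEvents :
    Measurable[(cylinderEvents (X := E) A).prod MeasurableSpace.pi]
      fun p : (∀ i, E i) × (∀ i, E i) => A.piecewise p.1 p.2 := by
  refine (@measurable_pi_iff _ _ _ ((cylinderEvents (X := E) A).prod MeasurableSpace.pi) _ _).2
    fun i => ?_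
  by_cases hi : i ∈ A
  · simp only [Set.piecewise, hi, if_true]
    exact (measurable_cylinderEvent_apply hi).comp
      (@measurable_fst _ _ (cylinderEvents A) MeasurableSpace.pi)
  · simp only [Set.piecewise, hi, if_false]
    exact (measurable_pi_apply i).comp
      (@measurable_snd _ _ (cylinderEvents A) MeasurableSpace.pi)

/-- Taking the coordinates in `A` from one sample and the others from an independent sample
gives a sample of the product measure. -/
theorem measurePreserving_piecewise_infinitePi :
    MeasurePreserving (fun p : (∀ i, E i) × (∀ i, E i) => A.piecewise p.1 p.2)
      ((Measure.infinitePi μ).prod (Measure.infinitePi μ)) (Measure.infinitePi μ) := by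
  refine ⟨measurable_piecewise_prod A, Measure.eq_infinitePi μ fun s t ht => ?_⟩
  have hbox : (fun p : (∀ i, E i) × (∀ i, E i) => A.piecewise p.1 p.2) ⁻¹' (Set.pi s t) =
      (Set.pi (s.filter (· ∈ A) : Finset ι) t) ×ˢ (Set.pi (s.filter (· ∉ A) : Finset ι) t) := by
    ext p
    simp only [Set.mem_preimage, Set.mem_pi, Set.mem_prod, Finset.mem_coe, Finset.mem_filter,
      and_imp]
    constructor
    · intro h
      refine ⟨fun i hi hA => ?_, fun i hi hA => ?_⟩
      · simpa [Set.piecewise, hA] using h i hi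
      · simpa [Set.piecewise, hA] using h i hi
    · rintro ⟨h1, h2⟩ i hi
      by_cases hA : i ∈ A
      · simpa [Set.piecewise, hA] using h1 i hi hA
      · simpa [Set.piecewise, hA] using h2 i hi hA
  rw [Measure.map_apply (measurable_piecewise_prod A)
    (.pi s.countable_toSet fun i _ => ht i), hbox, Measure.prod_prod,
    Measure.infinitePi_pi μ fun i _ => ht i, Measure.infinitePi_pi μ fun i _ => ht i,
    Finset.prod_filter_mul_prod_filter_not]

/-- Under a product measure, the conditional expectation given the coordinates in `A` integrates
the other coordinates out. -/
theorem condExp_cylinderEvents_ae_eq {f : (∀ i, E i) → ℝ} (hf : StronglyMeasurable f)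
    (hfi : Integrable f (Measure.infinitePi μ)) :
    (Measure.infinitePi μ)[f | cylinderEvents A] =ᵐ[Measure.infinitePi μ]
      fun x => ∫ y, f (A.piecewise x y) ∂(Measure.infinitePi μ) := by
  have hmp := measurePreserving_piecewise_infinitePi μ A
  have hint : ∀ {h : (∀ i, E i) → ℝ}, Integrable h (Measure.infinitePi μ) →
      Integrable (fun p : (∀ i, E i) × (∀ i, E i) => h (A.piecewise p.1 p.2))
        ((Measure.infinitePi μ).prod (Measure.infinitePi μ)) :=
    fun {h} hh => (hmp.integrable_comp hh.1).2 hh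
  refine (ae_eq_condExp_of_forall_setIntegral_eq cylinderEvents_le_pi hfi
    (fun s _ _ => (hint hfi).integral_prod_left.integrableOn) (fun D hD _ => ?_) ?_).symm
  · have hD' := cylinderEvents_le_pi D hD
    rw [← integral_indicator hD', ← integral_indicator hD']
    calc _ = ∫ x, ∫ y, D.indicator f (A.piecewise x y) ∂(Measure.infinitePi μ)
            ∂(Measure.infinitePi μ) := by
          refine integral_congr_ae (.of_forall fun x => ?_)
          have hmem : ∀ y, A.piecewise x y ∈ D ↔ x ∈ D := fun y =>
            mem_iff_of_eqOn_of_measurableSet_cylinderEvents hD fun i hi => by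
              simp [Set.piecewise, hi]
          by_cases hx : x ∈ D <;> simp [Set.indicator, hmem, hx]
      _ = _ := by
          rw [integral_integral (f := fun x y => D.indicator f (A.piecewise x y))
            (hint (hfi.indicator hD'))]
          conv_rhs => rw [← hmp.map_eq]
          rw [integral_map hmp.aemeasurable (hf.indicator hD').aestronglyMeasurable]
  · refine StronglyMeasurable.aestronglyMeasurable ?_
    exact @StronglyMeasurable.integral_prod_right _ _ _ (cylinderEvents A) _ _ _ _ _ _
      (hf.comp_measurable (measurable_piecewise_prod_cylinderEvents A))

/-- Conditional expectations given two sets of coordinates of a product measure commute. -/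
theorem condExp_condExp_cylinderEvents [∀ i, Decidable (i ∈ B)] {f : (∀ i, E i) → ℝ}
    (hfi : Integrable f (Measure.infinitePi μ)) :
    (Measure.infinitePi μ)[(Measure.infinitePi μ)[f | cylinderEvents A] | cylinderEvents B]
      =ᵐ[Measure.infinitePi μ] (Measure.infinitePi μ)[f | cylinderEvents (A ∩ B)] := by
  classical
  wlog hf : StronglyMeasurable f generalizing f
  · have hmk := hfi.1.ae_eq_mk
    have h := this (hfi.congr hmk) hfi.1.stronglyMeasurable_mk
    exact (condExp_congr_ae (condExp_congr_ae hmk)).trans (h.trans (condExp_congr_ae hmk.symm))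
  have h1 := condExp_cylinderEvents_ae_eq μ A hf hfi
  have hg : StronglyMeasurable fun x => ∫ y, f (A.piecewise x y) ∂(Measure.infinitePi μ) :=
    StronglyMeasurable.integral_prod_right (f := fun x y => f (A.piecewise x y))
      (hf.comp_measurable (measurable_piecewise_prod A))
  have hmpA := measurePreserving_piecewise_infinitePi μ A
  have hmpAB := measurePreserving_piecewise_infinitePi μ (A ∩ B)
  refine (condExp_congr_ae h1).trans ?_
  refine (condExp_cylinderEvents_ae_eq μ B hg (integrable_condExp.congr h1)).trans ?_
  refine EventuallyEq.trans ?_ (condExp_cylinderEvents_ae_eq μ (A ∩ B) hf hfi).symm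
  have hae := ((hmpAB.integrable_comp hfi.1).2 hfi).prod_right_ae
  filter_upwards [hae] with x hx
  have hpw : ∀ y z : ∀ i, E i, A.piecewise (B.piecewise x y) z =
      (A ∩ B).piecewise x (A.piecewise y z) := by
    intro y z
    ext i
    by_cases hA : i ∈ A <;> by_cases hB : i ∈ B <;> simp [Set.piecewise, hA, hB]
  simp only [hpw]
  have hx' : Integrable (fun w => f ((A ∩ B).piecewise x w)) (Measure.infinitePi μ) := hx
  rw [integral_integral (f := fun y z => f ((A ∩ B).piecewise x (A.piecewise y z)))
    ((hmpA.integrable_comp hx'.1).2 hx')]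
  conv_rhs => rw [← hmpA.map_eq]
  rw [integral_map hmpA.aemeasurable (by rw [hmpA.map_eq]; exact hx'.1)]

/-- Events that depend on disjoint sets of coordinates are independent. -/
theorem infinitePi_inter_of_disjoint (hAB : Disjoint A B) {C D : Set (∀ i, E i)}
    (hC : MeasurableSet[cylinderEvents A] C) (hD : MeasurableSet[cylinderEvents B] D) :
    Measure.infinitePi μ (C ∩ D) = Measure.infinitePi μ C * Measure.infinitePi μ D := by
  have hC' := cylinderEvents_le_pi C hC
  have hD' := cylinderEvents_le_pi D hD
  have hmp := measurePreserving_piecewise_infinitePi μ A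
  rw [← hmp.measure_preimage (hC'.inter hD').nullMeasurableSet, ← Measure.prod_prod]
  congr 1
  ext p
  refine and_congr (mem_iff_of_eqOn_of_measurableSet_cylinderEvents hC fun i hi => ?_)
    (mem_iff_of_eqOn_of_measurableSet_cylinderEvents hD fun i hi => ?_)
  · simp [Set.piecewise, hi]
  · simp [Set.piecewise, Set.disjoint_right.1 hAB hi]

end Cylinder

/-! ### Ergodicity of shifts -/

section Shift

open scoped symmDiff

variable {ι E : Type*} [MeasurableSpace E] (μ : ι → Measure E) [∀ i, IsProbabilityMeasure (μ i)]

theorem comap_comp_cylinderEvents (σ : ι → ι) (A : Set ι) :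
    (cylinderEvents (X := fun _ : ι => E) A).comap (fun (x : ι → E) i => x (σ i)) =
      cylinderEvents (σ '' A) := by
  simp only [cylinderEvents, MeasurableSpace.comap_iSup, MeasurableSpace.comap_comp, iSup_image]
  rfl

theorem measurePreserving_comp_infinitePi {σ : ι → ι} (hσ : σ.Injective)
    (hμ : ∀ i, μ (σ i) = μ i) :
    MeasurePreserving (fun (x : ι → E) i => x (σ i)) (Measure.infinitePi μ)
      (Measure.infinitePi μ) := by
  refine ⟨by fun_prop, ?_⟩
  have h := Measure.map_infinitePi_infinitePi_of_inj (P := μ) hσ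
  simp only [hμ] at h
  exact h

/-- A reindexing of an independent family that eventually moves each finite set of indices off
itself is ergodic: an invariant event `D` is approximated by an event `C` depending on finitely
many coordinates, which is independent of its far translates, so that `P D = (P D) ^ 2`. -/
theorem ergodic_comp_infinitePi {σ : ι → ι} (hσ : σ.Injective) (hμ : ∀ i, μ (σ i) = μ i)
    (hd : ∀ s : Finset ι, ∃ n : ℕ, Disjoint (s : Set ι) (σ^[n] '' s)) :
    Ergodic (fun (x : ι → E) i => x (σ i)) (Measure.infinitePi μ) := by
  classical
  set P := Measure.infinitePi μ with hP
  set f : (ι → E) → (ι → E) := fun x i => x (σ i) with hf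
  have hmp : MeasurePreserving f P P := measurePreserving_comp_infinitePi μ hσ hμ
  have hfn : ∀ n x, f^[n] x = fun i => x (σ^[n] i) := by
    intro n
    induction n with
    | zero => intro x; rfl
    | succ n ih =>
      intro x
      rw [Function.iterate_succ_apply, ih]
      funext i
      rw [Function.iterate_succ_apply']
  refine ⟨hmp, ⟨fun D hD hfD => ?_⟩⟩
  have hfDn : ∀ n, f^[n] ⁻¹' D = D := fun n => by
    induction n with
    | zero => rfl
    | succ n ih => rw [Function.iterate_succ, Set.preimage_comp, ih, hfD]
  have key : ∀ ε : ℝ, 0 < ε → |P.real D - P.real D * P.real D| ≤ 4 * ε := by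
    intro ε hε
    obtain ⟨C, hC, hCD⟩ := exists_measure_symmDiff_lt_of_generateFrom_isSetRing (μ := P)
      (isSetRing_measurableCylinders (α := fun _ : ι => E))
      ⟨{Set.univ}, Set.countable_singleton _, by
        simpa using univ_mem_measurableCylinders (fun _ : ι => E), by simp⟩
      generateFrom_measurableCylinders.symm hD (ENNReal.ofReal_pos.2 hε)
    have hCm : MeasurableSet C := .of_mem_measurableCylinders hC
    have hCD' : P.real (C ∆ D) ≤ ε := by
      rw [Measure.real]
      exact ENNReal.toReal_le_of_le_ofReal hε.le hCD.le
    obtain ⟨s, S, hS, rfl⟩ := (mem_measurableCylinders C).1 hC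
    set C := cylinder (α := fun _ : ι => E) s S
    have hCs : MeasurableSet[cylinderEvents (s : Set ι)] C :=
      measurable_restrict_cylinderEvents (s : Set ι) hS
    obtain ⟨n, hn⟩ := hd s
    have hCn : MeasurableSet[cylinderEvents (σ^[n] '' s)] (f^[n] ⁻¹' C) := by
      rw [← comap_comp_cylinderEvents]
      exact ⟨C, hCs, by ext x; simp only [Set.mem_preimage, hfn]⟩
    have hind : P.real (C ∩ f^[n] ⁻¹' C) = P.real C * P.real C := by
      rw [Measure.real, infinitePi_inter_of_disjoint μ _ _ hn hCs hCn, ENNReal.toReal_mul,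
        (hmp.iterate n).measure_preimage hCm.nullMeasurableSet]
      rfl
    have hfm := (hmp.iterate n).measurable
    have h1 : |P.real C - P.real D| ≤ ε :=
      (abs_measureReal_sub_le_measureReal_symmDiff hCm.nullMeasurableSet
        hD.nullMeasurableSet).trans hCD'
    have h2 : |P.real (C ∩ f^[n] ⁻¹' C) - P.real D| ≤ 2 * ε := by
      refine (abs_measureReal_sub_le_measureReal_symmDiff
        (hCm.inter (hfm hCm)).nullMeasurableSet hD.nullMeasurableSet).trans ?_
      have hsub : (C ∩ f^[n] ⁻¹' C) ∆ D ⊆ (C ∆ D) ∪ f^[n] ⁻¹' (C ∆ D) := by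
        intro x hx
        have hxD : f^[n] x ∈ D ↔ x ∈ D := by
          rw [← Set.mem_preimage, hfDn]
        simp only [Set.mem_symmDiff, Set.mem_inter_iff, Set.mem_preimage, Set.mem_union,
          hxD] at hx ⊢
        tauto
      refine (measureReal_mono hsub).trans ((measureReal_union_le _ _).trans ?_)
      have : P.real (f^[n] ⁻¹' (C ∆ D)) = P.real (C ∆ D) := by
        rw [Measure.real, (hmp.iterate n).measure_preimage (hCm.symmDiff hD).nullMeasurableSet]
        rfl
      linarith
    rw [hind] at h2
    have hC0 : 0 ≤ P.real C := measureReal_nonneg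
    have hC1 : P.real C ≤ 1 := measureReal_le_one
    have hD0 : 0 ≤ P.real D := measureReal_nonneg
    have hD1 : P.real D ≤ 1 := measureReal_le_one
    rw [abs_le] at h1 h2 ⊢
    constructor <;> nlinarith
  have h0 : P.real D - P.real D * P.real D = 0 := by
    refine abs_nonpos_iff.1 (le_of_forall_pos_le_add fun ε hε => ?_)
    have := key (ε / 4) (by positivity)
    linarith
  rw [eventuallyConst_set']
  rcases mul_eq_zero.1 (show P.real D * (1 - P.real D) = 0 by linarith) with h | h
  · left
    rw [measureReal_eq_zero_iff] at h
    exact ae_eq_empty.2 h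
  · right
    rw [ae_eq_univ, prob_compl_eq_zero_iff hD]
    have : P.real D = 1 := by linarith
    rwa [measureReal_def, ENNReal.toReal_eq_one_iff] at this

end Shift

/-! ### Conditional expectations and invariance -/

/-- A measure preserving map that fixes the events of `m` does not change conditional
expectations given `m`. -/
theorem condExp_comp_ae_eq_of_preimage_eq {Ω : Type*} {m mΩ : MeasurableSpace Ω} {P : Measure Ω}
    [IsFiniteMeasure P] (hm : m ≤ mΩ) {φ : Ω → Ω} (hφ : MeasurePreserving φ P P)
    (hinv : ∀ D, MeasurableSet[m] D → φ ⁻¹' D = D) {f : Ω → ℝ} (hf : Integrable f P) :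
    P[f ∘ φ | m] =ᵐ[P] P[f | m] := by
  refine ae_eq_condExp_of_forall_setIntegral_eq hm hf
    (fun s _ _ => integrable_condExp.integrableOn) (fun D hD _ => ?_)
    stronglyMeasurable_condExp.aestronglyMeasurable
  have hD' := hm D hD
  rw [setIntegral_condExp hm ((hφ.integrable_comp hf.1).2 hf) hD]
  conv_rhs => rw [← hφ.map_eq]
  rw [setIntegral_map hD' (by rw [hφ.map_eq]; exact hf.1) hφ.aemeasurable, hinv D hD]
  rfl

/-! ### Series in `ℝ≥0∞` -/

theorem tsum_ofReal_eq_top_of_not_summable {f : ℕ → ℝ} (hf : ∀ k, 0 ≤ f k) (h : ¬ Summable f) :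
    ∑' k, ENNReal.ofReal (f k) = ⊤ := by
  by_contra hne
  exact h (by simpa [ENNReal.toReal_ofReal, hf] using ENNReal.summable_toReal hne)

/-- A form of Cauchy condensation. -/
theorem tsum_two_pow_mul_le_tsum {f g : ℕ → ENNReal} (h : ∀ a i, i < 2 ^ (a + 1) → g a ≤ f i) :
    ∑' a, 2 ^ a * g a ≤ ∑' i, f i := by
  have hpart : ∀ n : ℕ, ∑ a ∈ Finset.range n, 2 ^ a * g a ≤ ∑ i ∈ Finset.range (2 ^ n), f i := by
    intro n
    induction n with
    | zero => simp
    | succ n ih =>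
      rw [Finset.sum_range_succ, pow_succ, mul_two, Finset.sum_range_add]
      refine add_le_add ih ?_
      have : ∀ i ∈ Finset.range (2 ^ n), g n ≤ f (2 ^ n + i) := fun i hi =>
        h n _ (by rw [Finset.mem_range] at hi; rw [pow_succ]; omega)
      simpa using Finset.card_nsmul_le_sum _ _ _ this
  rw [ENNReal.tsum_eq_iSup_nat]
  exact iSup_le fun n => (hpart n).trans (ENNReal.sum_le_tsum _)

theorem tsum_tsum_ofReal_inv_sq_eq_top (M : ℕ) :
    ∑' a : ℕ, ∑' b : ℕ, ENNReal.ofReal (((M + a + b + 1 : ℕ) : ℝ) ^ 2)⁻¹ = ⊤ := by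
  have hinner : ∀ a : ℕ, ENNReal.ofReal (1 / 4 * (1 / ((a + (M + 1) : ℕ) : ℝ))) ≤
      ∑' b : ℕ, ENNReal.ofReal (((M + a + b + 1 : ℕ) : ℝ) ^ 2)⁻¹ := by
    intro a
    set N := a + (M + 1) with hN
    have hN0 : (0 : ℝ) < N := by positivity
    refine le_trans ?_ (ENNReal.sum_le_tsum (Finset.range N))
    rw [← ENNReal.ofReal_sum_of_nonneg fun _ _ => by positivity]
    refine ENNReal.ofReal_le_ofReal ?_
    have : ∀ b ∈ Finset.range N, ((2 * (N : ℝ)) ^ 2)⁻¹ ≤ (((M + a + b + 1 : ℕ) : ℝ) ^ 2)⁻¹ := by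
      intro b hb
      have hle : M + a + b + 1 ≤ 2 * N := by rw [Finset.mem_range] at hb; omega
      have hle' : ((M + a + b + 1 : ℕ) : ℝ) ≤ 2 * N := by exact_mod_cast hle
      gcongr
    refine le_trans (le_of_eq ?_) (Finset.card_nsmul_le_sum _ _ _ this)
    rw [Finset.card_range, nsmul_eq_mul]
    field_simp
    norm_num
  refine top_le_iff.1 (le_trans (le_of_eq ?_) (ENNReal.tsum_le_tsum hinner))
  refine (tsum_ofReal_eq_top_of_not_summable (fun k => by positivity) fun h => ?_).symm
  have h' := (summable_mul_left_iff (by norm_num)).1 h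
  exact Real.not_summable_one_div_natCast
    ((summable_nat_add_iff (f := fun n : ℕ => 1 / (n : ℝ)) (M + 1)).1 h')

/-! ### The laws of the coordinates -/

/-- The fair coin on `{0, 1}`. -/
noncomputable def coinLaw : Measure ℕ :=
  (2⁻¹ : ENNReal) • (Measure.dirac 0 + Measure.dirac 1)

instance : IsProbabilityMeasure coinLaw where
  measure_univ := by
    simp [coinLaw, ENNReal.inv_two_add_inv_two]

/-- The coin flip; its values off `{0, 1}` are irrelevant, but the sign changes everywhere, see
`coinSign_coinFlip`. -/
def coinFlip (k : ℕ) : ℕ := if k = 0 then 1 else 0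

/-- The sign encoded by a coin. -/
def coinSign (k : ℕ) : ℝ := if k = 0 then 1 else -1

theorem coinSign_coinFlip (k : ℕ) : coinSign (coinFlip k) = -coinSign k := by
  by_cases h : k = 0 <;> simp [coinSign, coinFlip, h]

theorem abs_coinSign (k : ℕ) : |coinSign k| = 1 := by
  by_cases h : k = 0 <;> simp [coinSign, h]

theorem map_coinFlip_coinLaw : coinLaw.map coinFlip = coinLaw := by
  have hm : Measurable coinFlip := .of_discrete
  simp [coinLaw, Measure.map_add _ _ hm, Measure.map_dirac' hm, coinFlip, add_comm]

/-- The unnormalized weights of `sizeLaw`. -/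
noncomputable def sizeWeight (k : ℕ) : ENNReal :=
  ENNReal.ofReal (2 ^ k * ((k + 1 : ℕ) : ℝ) ^ 2)⁻¹

theorem summable_inv_natCast_succ_sq : Summable fun k : ℕ => (((k + 1 : ℕ) : ℝ) ^ 2)⁻¹ :=
  (summable_nat_add_iff (f := fun n : ℕ => ((n : ℝ) ^ 2)⁻¹) 1).2
    (Real.summable_nat_pow_inv.2 one_lt_two)

theorem tsum_sizeWeight_ne_zero : ∑' k, sizeWeight k ≠ 0 := by
  refine fun h => ?_
  have := ENNReal.tsum_eq_zero.1 h 0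
  simp [sizeWeight] at this

theorem tsum_sizeWeight_ne_top : ∑' k, sizeWeight k ≠ ⊤ := by
  refine Summable.tsum_ofReal_ne_top (.of_nonneg_of_le (fun k => by positivity) (fun k => ?_)
    summable_inv_natCast_succ_sq)
  gcongr
  exact le_mul_of_one_le_left (by positivity) (one_le_pow₀ one_le_two)

/-- The law of the exponent `k`: the size `√(2 ^ k)` has a probability proportional to
`2⁻ᵏ (k + 1)⁻²`. The second moment of the size is `∑ (k + 1)⁻²` up to a factor, and a factor
`log ^ s` turns the series into `∑ (k + 1) ^ (s - 2)`. -/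
noncomputable def sizeLaw : Measure ℕ :=
  (PMF.normalize sizeWeight tsum_sizeWeight_ne_zero tsum_sizeWeight_ne_top).toMeasure

instance : IsProbabilityMeasure sizeLaw := by unfold sizeLaw; infer_instance

theorem sizeLaw_singleton (k : ℕ) :
    sizeLaw {k} = sizeWeight k * (∑' i, sizeWeight i)⁻¹ := by
  rw [sizeLaw, PMF.toMeasure_apply_singleton _ _ (measurableSet_singleton k),
    PMF.normalize_apply]

theorem lintegral_sizeLaw {h : ℕ → ℝ} (hh : ∀ k, 0 ≤ h k) :
    ∫⁻ k, ENNReal.ofReal (h k) ∂sizeLaw =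
      (∑' k, ENNReal.ofReal (h k * (2 ^ k * ((k + 1 : ℕ) : ℝ) ^ 2)⁻¹)) *
        (∑' i, sizeWeight i)⁻¹ := by
  rw [lintegral_countable', ← ENNReal.tsum_mul_right]
  refine tsum_congr fun k => ?_
  rw [sizeLaw_singleton, sizeWeight, ← mul_assoc, ENNReal.ofReal_mul (hh k)]

theorem lintegral_two_pow_sizeLaw_lt_top :
    ∫⁻ k, ENNReal.ofReal (2 ^ k) ∂sizeLaw < ⊤ := by
  rw [lintegral_sizeLaw fun k => by positivity]
  refine ENNReal.mul_lt_top (Ne.lt_top ?_) (ENNReal.inv_lt_top.2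
    (pos_iff_ne_zero.2 tsum_sizeWeight_ne_zero))
  refine Summable.tsum_ofReal_ne_top (summable_inv_natCast_succ_sq.congr fun k => ?_)
  field_simp

theorem lintegral_two_pow_mul_log_sizeLaw :
    ∫⁻ k, ENNReal.ofReal (2 ^ k * Real.log (1 + √(2 ^ k))) ∂sizeLaw = ⊤ := by
  have hlog0 : ∀ k : ℕ, 0 ≤ Real.log (1 + √(2 ^ k)) := fun k =>
    Real.log_nonneg (by linarith [Real.sqrt_nonneg ((2 : ℝ) ^ k)])
  rw [lintegral_sizeLaw fun k => mul_nonneg (by positivity) (hlog0 k)]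
  have hns : ¬ Summable fun k : ℕ => 1 / 16 * (1 / (k : ℝ)) := fun h =>
    Real.not_summable_one_div_natCast ((summable_mul_left_iff (by norm_num)).1 h)
  have hle : ∀ k : ℕ, 1 / 16 * (1 / (k : ℝ)) ≤
      2 ^ k * Real.log (1 + √(2 ^ k)) * (2 ^ k * ((k + 1 : ℕ) : ℝ) ^ 2)⁻¹ := by
    intro k
    have h1 : (k : ℝ) / 4 ≤ Real.log (1 + √(2 ^ k)) := by
      calc (k : ℝ) / 4 ≤ k * Real.log 2 / 2 := by
            have : (0 : ℝ) ≤ k := k.cast_nonneg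
            nlinarith [Real.log_two_gt_d9]
        _ = Real.log √(2 ^ k) := by rw [Real.log_sqrt (by positivity), Real.log_pow]
        _ ≤ _ := Real.log_le_log (by positivity) (by linarith)
    rcases k.eq_zero_or_pos with rfl | hk
    · simpa using hlog0 0
    · have hk1 : (1 : ℝ) ≤ k := by exact_mod_cast hk
      calc 1 / 16 * (1 / (k : ℝ)) ≤ k / 4 * (((k + 1 : ℕ) : ℝ) ^ 2)⁻¹ := by
            push_cast
            rw [← div_eq_mul_inv, div_div, div_mul_div_comm,
              div_le_div_iff₀ (by positivity) (by positivity)]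
            nlinarith
        _ ≤ Real.log (1 + √(2 ^ k)) * (((k + 1 : ℕ) : ℝ) ^ 2)⁻¹ := by gcongr
        _ = _ := by field_simp
  rw [top_le_iff.1 ((tsum_ofReal_eq_top_of_not_summable (fun k => by positivity) hns).symm.le.trans
    (ENNReal.tsum_le_tsum fun k => ENNReal.ofReal_le_ofReal (hle k)))]
  exact ENNReal.top_mul (ENNReal.inv_ne_zero.2 tsum_sizeWeight_ne_top)

theorem lintegral_two_pow_mul_log_rpow_sizeLaw_lt_top {ε : ℝ} (hε : 0 < ε) (hε1 : ε < 1) :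
    ∫⁻ k, ENNReal.ofReal (2 ^ k * Real.log (1 + √(2 ^ k)) ^ (1 - ε)) ∂sizeLaw < ⊤ := by
  have hlog0 : ∀ k : ℕ, 0 ≤ Real.log (1 + √(2 ^ k)) := fun k =>
    Real.log_nonneg (by linarith [Real.sqrt_nonneg ((2 : ℝ) ^ k)])
  rw [lintegral_sizeLaw fun k => mul_nonneg (by positivity) (Real.rpow_nonneg (hlog0 k) _)]
  refine ENNReal.mul_lt_top (Ne.lt_top ?_) (ENNReal.inv_lt_top.2
    (pos_iff_ne_zero.2 tsum_sizeWeight_ne_zero))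
  have hsum : Summable fun k : ℕ => ((k + 1 : ℕ) : ℝ) ^ (-(1 + ε)) :=
    (summable_nat_add_iff (f := fun n : ℕ => (n : ℝ) ^ (-(1 + ε))) 1).2
      (Real.summable_nat_rpow.2 (by linarith))
  refine Summable.tsum_ofReal_ne_top (.of_nonneg_of_le
    (fun k => mul_nonneg (mul_nonneg (by positivity) (Real.rpow_nonneg (hlog0 k) _))
      (by positivity)) (fun k => ?_) hsum)
  have hk : (0 : ℝ) < (k + 1 : ℕ) := by positivity
  have hle : Real.log (1 + √(2 ^ k)) ≤ (k + 1 : ℕ) := by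
    have h1 : (1 : ℝ) ≤ 2 ^ k := one_le_pow₀ one_le_two
    have h2 : √((2 : ℝ) ^ k) ≤ 2 ^ k := Real.sqrt_le_iff.2 ⟨by positivity, by nlinarith⟩
    calc Real.log (1 + √(2 ^ k)) ≤ Real.log (2 ^ (k + 1)) := by
          refine Real.log_le_log (by positivity) ?_
          rw [pow_succ]
          linarith
      _ = (k + 1 : ℕ) * Real.log 2 := Real.log_pow _ _
      _ ≤ (k + 1 : ℕ) * 1 := by
          gcongr
          linarith [Real.log_two_lt_d9]
      _ = _ := mul_one _
  calc 2 ^ k * Real.log (1 + √(2 ^ k)) ^ (1 - ε) * (2 ^ k * ((k + 1 : ℕ) : ℝ) ^ 2)⁻¹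
      = Real.log (1 + √(2 ^ k)) ^ (1 - ε) * (((k + 1 : ℕ) : ℝ) ^ 2)⁻¹ := by field_simp
    _ ≤ ((k + 1 : ℕ) : ℝ) ^ (1 - ε) * (((k + 1 : ℕ) : ℝ) ^ 2)⁻¹ := by
        exact mul_le_mul_of_nonneg_right (Real.rpow_le_rpow (hlog0 k) hle (by linarith))
          (by positivity)
    _ = ((k + 1 : ℕ) : ℝ) ^ (-(1 + ε)) := by
        rw [← Real.rpow_natCast _ 2, ← Real.rpow_neg hk.le, ← Real.rpow_add hk]
        congr 1
        push_cast
        ring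

/-- The tails of `sizeLaw`, summed over the lattice, diverge: the sum over the dyadic block
`i ∼ 2 ^ a`, `j ∼ 2 ^ b` is of the order `(a + b) ^ (-2)`. -/
theorem tsum_sizeLaw_tail_eq_top (m K : ℕ) :
    ∑' (i : ℕ) (j : ℕ), sizeLaw {k | 2 ^ m * ((K + i + 1) * (K + j + 1)) ≤ 2 ^ k} = ⊤ := by
  set c := (∑' i, sizeWeight i)⁻¹ with hc
  have hc0 : c ≠ 0 := ENNReal.inv_ne_zero.2 tsum_sizeWeight_ne_top
  set M := m + 2 * K + 2 with hM
  have hlin : ∀ a i : ℕ, i < 2 ^ (a + 1) → K + i + 1 ≤ 2 ^ (K + (a + 1)) := by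
    intro a i hi
    have hK : K + 1 ≤ 2 ^ K := Nat.lt_two_pow_self
    rw [pow_add]
    calc K + i + 1 ≤ (K + 1) * (i + 1) := by nlinarith [Nat.zero_le (K * i)]
      _ ≤ _ := Nat.mul_le_mul hK hi
  have hw : ∀ a b : ℕ, ∀ i < 2 ^ (a + 1), ∀ j < 2 ^ (b + 1), sizeWeight (M + a + b) * c ≤
      sizeLaw {k | 2 ^ m * ((K + i + 1) * (K + j + 1)) ≤ 2 ^ k} := by
    intro a b i hi j hj
    rw [← sizeLaw_singleton]
    refine measure_mono (Set.singleton_subset_iff.2 ?_)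
    rw [Set.mem_ofPred_eq, show M + a + b = m + ((K + (a + 1)) + (K + (b + 1))) by omega,
      pow_add 2 m, pow_add 2 (K + (a + 1))]
    gcongr
    exacts [hlin a i hi, hlin b j hj]
  have h1 : ∑' (a : ℕ), 2 ^ a * ∑' (b : ℕ), 2 ^ b * (sizeWeight (M + a + b) * c) ≤
      ∑' (i : ℕ) (j : ℕ), sizeLaw {k | 2 ^ m * ((K + i + 1) * (K + j + 1)) ≤ 2 ^ k} :=
    tsum_two_pow_mul_le_tsum fun a i hi => tsum_two_pow_mul_le_tsum fun b j hj => hw a b i hi j hj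
  refine top_le_iff.1 (le_trans (le_of_eq ?_) h1)
  have hterm : ∀ a b : ℕ, 2 ^ a * (2 ^ b * (sizeWeight (M + a + b) * c)) =
      ENNReal.ofReal (2 ^ M)⁻¹ * c * ENNReal.ofReal (((M + a + b + 1 : ℕ) : ℝ) ^ 2)⁻¹ := by
    intro a b
    have h2 : ∀ n : ℕ, (2 : ENNReal) ^ n = ENNReal.ofReal (2 ^ n) := fun n => by
      rw [ENNReal.ofReal_pow zero_le_two, ENNReal.ofReal_ofNat]
    rw [mul_right_comm, ← mul_assoc, ← mul_assoc]
    congr 1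
    rw [h2, h2, sizeWeight, ← ENNReal.ofReal_mul (by positivity),
      ← ENNReal.ofReal_mul (by positivity), ← ENNReal.ofReal_mul (by positivity)]
    congr 1
    rw [pow_add, pow_add]
    field_simp
  simp_rw [← ENNReal.tsum_mul_left, hterm, ENNReal.tsum_mul_left]
  rw [tsum_tsum_ofReal_inv_sq_eq_top, ENNReal.mul_top]
  exact mul_ne_zero (by simp) hc0

/-! ### The model -/

/-- The index set of the coordinates: `inl p` carries the coin and `inr p` the size exponent of
the lattice site `p`. -/
abbrev Coord := (ℤ × ℤ) ⊕ (ℤ × ℤ)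

/-- The laws of the coordinates. -/
noncomputable def coordLaw : Coord → Measure ℕ := Sum.elim (fun _ => coinLaw) fun _ => sizeLaw

instance (s : Coord) : IsProbabilityMeasure (coordLaw s) := by
  cases s <;> simp only [coordLaw, Sum.elim_inl, Sum.elim_inr] <;> infer_instance

/-- The law of the independent coins and sizes. -/
noncomputable abbrev fieldLaw : Measure (Coord → ℕ) := Measure.infinitePi coordLaw

/-- The translation of the coordinates by `d`. -/
def coordShift (d : ℤ × ℤ) : Coord → Coord := Sum.map (· + d) (· + d)

theorem coordShift_injective (d : ℤ × ℤ) : (coordShift d).Injective :=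
  Sum.map_injective.2 ⟨add_left_injective d, add_left_injective d⟩

theorem coordLaw_coordShift (d : ℤ × ℤ) (s : Coord) : coordLaw (coordShift d s) = coordLaw s := by
  cases s <;> rfl

theorem coordShift_coordShift (d e : ℤ × ℤ) (s : Coord) :
    coordShift d (coordShift e s) = coordShift (d + e) s := by
  cases s <;> simp [coordShift, add_assoc, add_comm d e]

theorem coordShift_zero (s : Coord) : coordShift 0 s = s := by
  cases s <;> simp [coordShift]

/-- The action of `ℤ²` on configurations by shifts. -/
def configShift : Multiplicative (ℤ × ℤ) →* Equiv.Perm (Coord → ℕ) where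
  toFun d :=
    { toFun := fun x s => x (coordShift d.toAdd s)
      invFun := fun x s => x (coordShift (-d.toAdd) s)
      left_inv := fun x => by simp [coordShift_coordShift, coordShift_zero]
      right_inv := fun x => by simp [coordShift_coordShift, coordShift_zero] }
  map_one' := by ext x s; simp [coordShift_zero]
  map_mul' d e := by
    ext x s
    simp [coordShift_coordShift, add_comm]

theorem configShift_apply (d : ℤ × ℤ) (x : Coord → ℕ) (s : Coord) :
    configShift (.ofAdd d) x s = x (coordShift d s) := rfl

theorem measurable_configShift_symm (d : ℤ × ℤ) :
    Measurable (configShift (.ofAdd d)).symm :=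
  measurable_pi_iff.2 fun _ => measurable_pi_apply _

theorem coordShift_iterate (d : ℤ × ℤ) (n : ℕ) (s : Coord) :
    (coordShift d)^[n] s = coordShift (n • d) s := by
  induction n with
  | zero => simp [coordShift_zero]
  | succ n ih => rw [Function.iterate_succ_apply', ih, coordShift_coordShift, succ_nsmul, add_comm]

theorem ergodic_configShift {d : ℤ × ℤ} (hd : d ≠ 0) :
    Ergodic (configShift (.ofAdd d)) fieldLaw := by
  refine ergodic_comp_infinitePi coordLaw (coordShift_injective d) (coordLaw_coordShift d)
    fun s => ?_
  -- For each pair of members of `s`, at most one iterate carries the first to the second.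
  have hfin : (⋃ p ∈ (s ×ˢ s : Finset (Coord × Coord)),
      {n : ℕ | coordShift (n • d) p.1 = p.2}).Finite := by
    refine Set.Finite.biUnion (Finset.finite_toSet _) fun p _ => Set.Subsingleton.finite ?_
    intro n hn n' hn'
    have h : coordShift (n • d) p.1 = coordShift (n' • d) p.1 := hn.trans hn'.symm
    have h' : n • d = n' • d := by
      rcases p with ⟨q | q, r⟩ <;> simpa [coordShift] using h
    rw [← natCast_zsmul, ← natCast_zsmul] at h'
    exact Nat.cast_injective (smul_left_injective ℤ hd h')
  obtain ⟨n, hn⟩ := hfin.exists_notMem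
  refine ⟨n, Set.disjoint_left.2 ?_⟩
  rintro _ ht ⟨t, hts, rfl⟩
  rw [coordShift_iterate] at ht
  exact hn (Set.mem_biUnion (x := (t, coordShift (n • d) t))
    (Finset.mem_coe.2 (Finset.mk_mem_product hts ht)) rfl)

theorem shiftMap_configShift (i j : ℤ) :
    shiftMap (configShift (.ofAdd (1, 0))) (configShift (.ofAdd (0, 1))) i j =
      fun x s => x (coordShift (i, j) s) := by
  funext x s
  rw [shiftMap, ← map_zpow configShift, ← map_zpow configShift, ← Equiv.Perm.mul_apply,
    ← map_mul configShift, ← ofAdd_zsmul,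
    ← ofAdd_zsmul, ← ofAdd_add, configShift_apply]
  simp

/-- The coordinates known at `(u, v)`: the coins in the quadrant below `(u, v)` and all sizes. -/
def knownCoords (u v : ℤ) : Set Coord := Sum.inl '' Set.Iic (u, v) ∪ Set.range Sum.inr

theorem inl_mem_knownCoords {i j u v : ℤ} :
    Sum.inl (i, j) ∈ knownCoords u v ↔ i ≤ u ∧ j ≤ v := by
  simp [knownCoords]

theorem inr_mem_knownCoords (p : ℤ × ℤ) (u v : ℤ) : Sum.inr p ∈ knownCoords u v := by
  simp [knownCoords]

theorem image_coordShift_knownCoords (i j : ℤ) :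
    coordShift (i, j) '' knownCoords 0 0 = knownCoords i j := by
  have hsurj : ∀ s, coordShift (i, j) (coordShift (-(i, j)) s) = s := fun s => by
    rw [coordShift_coordShift, add_neg_cancel, coordShift_zero]
  ext s
  rw [← hsurj s, (coordShift_injective (i, j)).mem_set_image, hsurj]
  rcases s with ⟨a, b⟩ | p
  · simp [coordShift, inl_mem_knownCoords]
  · simp [coordShift, inr_mem_knownCoords]

theorem knownCoords_inter (a b u v : ℤ) :
    knownCoords a b ∩ knownCoords u v = knownCoords (min a u) (min b v) := by
  ext s
  rcases s with ⟨i, j⟩ | p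
  · simp only [Set.mem_inter_iff, inl_mem_knownCoords, le_min_iff]
    tauto
  · simp [inr_mem_knownCoords]

theorem knownCoords_mono {a b u v : ℤ} (h : a ≤ u) (h' : b ≤ v) :
    knownCoords a b ⊆ knownCoords u v := by
  rintro (⟨i, j⟩ | p) hs
  · rw [inl_mem_knownCoords] at hs ⊢
    exact ⟨hs.1.trans h, hs.2.trans h'⟩
  · exact inr_mem_knownCoords p u v

/-- The σ-field of the coordinates known at `(u, v)`. -/
abbrev knownEvents (u v : ℤ) : MeasurableSpace (Coord → ℕ) :=
  cylinderEvents (X := fun _ : Coord => ℕ) (knownCoords u v)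

theorem shiftFiltration_configShift (i j : ℤ) :
    shiftFiltration (configShift (.ofAdd (1, 0))) (configShift (.ofAdd (0, 1)))
      (knownEvents 0 0) i j = knownEvents i j := by
  rw [shiftFiltration, shiftMap_configShift, comap_comp_cylinderEvents,
    image_coordShift_knownCoords]

/-- The value at the site `p`: its size with the sign of its coin. -/
noncomputable def signedSize (p : ℤ × ℤ) (x : Coord → ℕ) : ℝ :=
  coinSign (x (Sum.inl p)) * √(2 ^ x (Sum.inr p))

theorem shiftField_configShift (i j : ℤ) :
    shiftField (configShift (.ofAdd (1, 0))) (configShift (.ofAdd (0, 1)))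
      (signedSize (0, 0)) i j = signedSize (i, j) := by
  funext x
  rw [shiftField, shiftMap_configShift]
  simp [signedSize, coordShift]

theorem measurable_signedSize_of_mem {A : Set Coord} {p : ℤ × ℤ} (h : Sum.inl p ∈ A)
    (h' : Sum.inr p ∈ A) :
    Measurable[cylinderEvents (X := fun _ : Coord => ℕ) A] (signedSize p) := by
  have h1 : Measurable[cylinderEvents (X := fun _ : Coord => ℕ) A]
      fun x : Coord → ℕ => coinSign (x (Sum.inl p)) :=
    (Measurable.of_discrete (f := coinSign)).comp (measurable_cylinderEvent_apply h)
  have h2 : Measurable[cylinderEvents (X := fun _ : Coord => ℕ) A]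
      fun x : Coord → ℕ => √((2 : ℝ) ^ x (Sum.inr p)) :=
    (Measurable.of_discrete (f := fun k : ℕ => √((2 : ℝ) ^ k))).comp
      (measurable_cylinderEvent_apply h')
  exact h1.mul h2

theorem measurable_signedSize (p : ℤ × ℤ) : Measurable (signedSize p) := by
  exact (measurable_signedSize_of_mem (Set.mem_univ (Sum.inl p)) (Set.mem_univ (Sum.inr p))).mono
    cylinderEvents_le_pi le_rfl

theorem abs_signedSize (p : ℤ × ℤ) (x : Coord → ℕ) :
    |signedSize p x| = √(2 ^ x (Sum.inr p)) := by
  rw [signedSize, abs_mul, abs_coinSign, one_mul, abs_of_nonneg (Real.sqrt_nonneg _)]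

theorem signedSize_sq (p : ℤ × ℤ) (x : Coord → ℕ) :
    signedSize p x ^ 2 = 2 ^ x (Sum.inr p) := by
  rw [← sq_abs, abs_signedSize, Real.sq_sqrt (by positivity)]

theorem lintegral_size (p : ℤ × ℤ) (h : ℕ → ENNReal) :
    ∫⁻ x, h (x (Sum.inr p)) ∂fieldLaw = ∫⁻ k, h k ∂sizeLaw :=
  (measurePreserving_eval_infinitePi coordLaw (Sum.inr p)).lintegral_comp .of_discrete

theorem memLp_signedSize (p : ℤ × ℤ) : MemLp (signedSize p) 2 fieldLaw := by
  have hm := (measurable_signedSize p).aestronglyMeasurable (μ := fieldLaw)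
  refine (memLp_two_iff_integrable_sq hm).2 ⟨hm.pow 2, ?_⟩
  rw [hasFiniteIntegral_iff_ofReal (.of_forall fun x => sq_nonneg _)]
  simp only [signedSize_sq]
  rw [lintegral_size p fun k => ENNReal.ofReal (2 ^ k)]
  exact lintegral_two_pow_sizeLaw_lt_top

/-! ### Flipping one coin -/

/-- The configuration with the coin at `p` flipped. -/
def flipAt (p : ℤ × ℤ) (x : Coord → ℕ) : Coord → ℕ :=
  fun s => (if s = Sum.inl p then coinFlip else id) (x s)

theorem measurePreserving_flipAt (p : ℤ × ℤ) :
    MeasurePreserving (flipAt p) fieldLaw fieldLaw := by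
  have hm : ∀ s : Coord, Measurable (if s = Sum.inl p then coinFlip else id) := fun s =>
    .of_discrete
  refine ⟨measurable_pi_iff.2 fun s => (hm s).comp (measurable_pi_apply s), ?_⟩
  have h := Measure.infinitePi_map_pi coordLaw hm
  have hlaw : ∀ s : Coord, (coordLaw s).map (if s = Sum.inl p then coinFlip else id) =
      coordLaw s := by
    intro s
    split_ifs with hs
    · subst hs
      exact map_coinFlip_coinLaw
    · exact Measure.map_id
  simp only [hlaw] at h
  exact h

theorem signedSize_flipAt_self (p : ℤ × ℤ) (x : Coord → ℕ) :
    signedSize p (flipAt p x) = -signedSize p x := by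
  simp [signedSize, flipAt, coinSign_coinFlip]

theorem signedSize_flipAt_of_ne {p q : ℤ × ℤ} (h : q ≠ p) (x : Coord → ℕ) :
    signedSize q (flipAt p x) = signedSize q x := by
  simp [signedSize, flipAt, h]

theorem preimage_flipAt_eq {i j u v : ℤ} (h : u < i ∨ v < j) {D : Set (Coord → ℕ)}
    (hD : MeasurableSet[knownEvents u v] D) : flipAt (i, j) ⁻¹' D = D := by
  ext x
  refine mem_iff_of_eqOn_of_measurableSet_cylinderEvents hD fun s hs => ?_
  have : s ≠ Sum.inl (i, j) := by
    rintro rfl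
    rw [inl_mem_knownCoords] at hs
    omega
  simp [flipAt, this]

/-- A coin that is not known at `(u, v)` makes the value at its site conditionally symmetric. -/
theorem condExp_signedSize_ae_eq_zero {i j u v : ℤ} (h : u < i ∨ v < j) :
    fieldLaw[signedSize (i, j) | knownEvents u v] =ᵐ[fieldLaw] 0 := by
  have hint : Integrable (signedSize (i, j)) fieldLaw :=
    (memLp_signedSize (i, j)).integrable one_le_two
  have hflip := condExp_comp_ae_eq_of_preimage_eq cylinderEvents_le_pi
    (measurePreserving_flipAt (i, j)) (fun D hD => preimage_flipAt_eq h hD) hint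
  have hneg : signedSize (i, j) ∘ flipAt (i, j) = -signedSize (i, j) :=
    funext fun x => signedSize_flipAt_self (i, j) x
  rw [hneg] at hflip
  filter_upwards [hflip, condExp_neg (μ := fieldLaw) (signedSize (i, j)) (knownEvents u v)]
    with x h1 h2
  rw [h2, Pi.neg_apply] at h1
  simp only [Pi.zero_apply]
  linarith

theorem measurable_rectSum (n v : ℕ) :
    Measurable (rectSum (fun i j => signedSize (i, j)) n v) := by
  unfold rectSum
  exact Finset.measurable_sum _ fun i _ => Finset.measurable_sum _ fun j _ =>
    measurable_signedSize _

theorem rectSum_flipAt (i j : ℕ) (x : Coord → ℕ) :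
    rectSum (fun i j => signedSize (i, j)) (i + 1) (j + 1) (flipAt (i, j) x) =
      rectSum (fun i j => signedSize (i, j)) (i + 1) (j + 1) x - 2 * signedSize (i, j) x := by
  have h : rectSum (fun i j => signedSize (i, j)) (i + 1) (j + 1) (flipAt (i, j) x) -
      rectSum (fun i j => signedSize (i, j)) (i + 1) (j + 1) x =
      signedSize (i, j) (flipAt (i, j) x) - signedSize (i, j) x := by
    simp only [rectSum, ← Finset.sum_sub_distrib]
    rw [Finset.sum_eq_single_of_mem i (Finset.self_mem_range_succ i),
      Finset.sum_eq_single_of_mem j (Finset.self_mem_range_succ j)]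
    · intro b _ hb
      rw [signedSize_flipAt_of_ne (by simpa using hb), sub_self]
    · intro a _ ha
      refine Finset.sum_eq_zero fun b _ => ?_
      rw [signedSize_flipAt_of_ne (by simp [ha]), sub_self]
  rw [signedSize_flipAt_self] at h
  linarith

/-- Given the sizes, a partial sum exceeds the size at its corner with probability at least `1/2`:
flipping the coin of the corner changes the sum by twice that size. -/
theorem half_le_quenchedMeasure_rectSum {i j : ℕ} (hij : 0 < i) (r : ℝ) :
    ∀ᵐ x ∂fieldLaw, r ≤ √(2 ^ x (Sum.inr ((i : ℤ), (j : ℤ)))) →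
      1 / 2 ≤ quenchedMeasure (knownEvents 0 0) fieldLaw x
        {y | r ≤ |rectSum (fun i j => signedSize (i, j)) (i + 1) (j + 1) y|} := by
  set S := rectSum (fun i j => signedSize (i, j)) (i + 1) (j + 1) with hS
  set φ := flipAt (i, j) with hφ
  set D := {y | r ≤ |S y|} with hD
  set B := {x : Coord → ℕ | r ≤ √(2 ^ x (Sum.inr ((i : ℤ), (j : ℤ))))} with hB
  have hm : knownEvents 0 0 ≤ MeasurableSpace.pi := cylinderEvents_le_pi
  have hDm : MeasurableSet D :=
    measurableSet_le measurable_const (measurable_rectSum (i + 1) (j + 1)).abs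
  have hBm : MeasurableSet[knownEvents 0 0] B :=
    measurable_cylinderEvent_apply (X := fun _ : Coord => ℕ)
      (inr_mem_knownCoords ((i : ℤ), (j : ℤ)) 0 0)
      (MeasurableSet.of_discrete (s := {k : ℕ | r ≤ √(2 ^ k)}))
  set f : (Coord → ℕ) → ℝ := D.indicator fun _ => 1 with hf
  have hfi : Integrable f fieldLaw := (integrable_const 1).indicator hDm
  have hmp := measurePreserving_flipAt (i, j)
  have hfφ : Integrable (f ∘ φ) fieldLaw := (hmp.integrable_comp hfi.1).2 hfi
  have hBi : Integrable (B.indicator fun _ => (1 : ℝ)) fieldLaw :=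
    (integrable_const 1).indicator (hm B hBm)
  have hle : B.indicator (fun _ => (1 : ℝ)) ≤ f + f ∘ φ := by
    intro y
    have h0 : ∀ z, 0 ≤ f z := fun z => Set.indicator_nonneg (fun _ _ => zero_le_one) z
    by_cases hy : y ∈ B
    · rw [Set.indicator_of_mem hy, Pi.add_apply]
      have hflip := rectSum_flipAt i j y
      have hsize : r ≤ |signedSize (i, j) y| := by rw [abs_signedSize]; exact hy
      have htri : 2 * |signedSize (i, j) y| ≤ |S y| + |S (φ y)| := by
        have h2 : 2 * signedSize (i, j) y = S y - S (φ y) := by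
          rw [hS, hφ, hflip]
          ring
        rw [← abs_two (α := ℝ), ← abs_mul, h2]
        exact abs_sub _ _
      rcases le_total |S (φ y)| |S y| with h | h
      · have : y ∈ D := show r ≤ |S y| by linarith
        linarith [h0 (φ y), show f y = 1 from Set.indicator_of_mem this _,
          show (f ∘ φ) y = f (φ y) from rfl]
      · have : φ y ∈ D := show r ≤ |S (φ y)| by linarith
        linarith [h0 y, show f (φ y) = 1 from Set.indicator_of_mem this _,
          show (f ∘ φ) y = f (φ y) from rfl]
    · rw [Set.indicator_of_notMem hy]
      exact add_nonneg (h0 _) (h0 _)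
  have hker := condExpKernel_ae_eq_condExp (μ := fieldLaw) hm hDm
  have hinv := condExp_comp_ae_eq_of_preimage_eq hm hmp
    (fun E hE => preimage_flipAt_eq (Or.inl (by exact_mod_cast hij)) hE) hfi
  filter_upwards [hker, hinv, condExp_mono (m := knownEvents 0 0) hBi (hfi.add hfφ) (.of_forall hle),
    condExp_add hfi hfφ (knownEvents 0 0)] with x h1 h2 h3 h4 hx
  rw [condExp_of_stronglyMeasurable hm (stronglyMeasurable_const.indicator hBm) hBi,
    Set.indicator_of_mem (show x ∈ B from hx), h4, Pi.add_apply, h2] at h3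
  have h5 : (1 / 2 : ℝ) ≤ (quenchedMeasure (knownEvents 0 0) fieldLaw x).real D := by
    rw [quenchedMeasure, h1]
    linarith
  rw [measureReal_def] at h5
  have := ENNReal.ofReal_le_of_le_toReal h5
  rwa [ENNReal.ofReal_div_of_pos two_pos, ENNReal.ofReal_one, ENNReal.ofReal_ofNat] at this

/-! ### Exceptional sizes -/

/-- The exceedances of the sizes over the area of the rectangle are independent, and the sum of
their probabilities over each quadrant diverges, so that Borel–Cantelli applies. -/
theorem ae_exists_exceptional_size (m K : ℕ) :
    ∀ᵐ x ∂fieldLaw, ∃ i j : ℕ, K ≤ i ∧ K ≤ j ∧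
      2 ^ m * ((i + 1) * (j + 1)) ≤ 2 ^ x (Sum.inr ((i : ℤ), (j : ℤ))) := by
  set c : ℕ → Coord := fun n =>
    Sum.inr (((K + n.unpair.1 : ℕ) : ℤ), ((K + n.unpair.2 : ℕ) : ℤ)) with hc
  set t : ℕ → Set ℕ := fun n =>
    {k | 2 ^ m * ((K + n.unpair.1 + 1) * (K + n.unpair.2 + 1)) ≤ 2 ^ k} with ht
  set s : ℕ → Set (Coord → ℕ) := fun n => (fun x => x (c n)) ⁻¹' t n with hs
  have hcinj : c.Injective := by
    intro n n' h
    simp only [hc, Sum.inr.injEq, Prod.mk.injEq, Nat.cast_inj, Nat.add_left_cancel_iff] at h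
    rw [← Nat.pair_unpair n, ← Nat.pair_unpair n', h.1, h.2]
  have hsm : ∀ n, MeasurableSet (s n) := fun n => measurable_pi_apply (c n) .of_discrete
  have hind : iIndepSet s fieldLaw := by
    have h := (iIndepFun_infinitePi (P := coordLaw) (X := fun _ (k : ℕ) => k)
      (fun _ => measurable_id)).precomp hcinj
    exact (iIndepSet_iff_meas_biInter hsm).2 fun F =>
      (iIndepFun_iff_measure_inter_preimage_eq_mul.1 h) F fun _ _ => .of_discrete
  have hsum : ∑' n, fieldLaw (s n) = ⊤ := by
    have hPs : ∀ n, fieldLaw (s n) = sizeLaw (t n) := fun n =>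
      (measurePreserving_eval_infinitePi coordLaw (c n)).measure_preimage
        MeasurableSet.of_discrete.nullMeasurableSet
    simp_rw [hPs]
    rw [← tsum_sizeLaw_tail_eq_top m K, ← ENNReal.tsum_prod, ← Nat.pairEquiv.symm.tsum_eq]
    rfl
  have hlim := measure_limsup_eq_one hsm hind hsum
  have hae : ∀ᵐ x ∂fieldLaw, x ∈ limsup s atTop := by
    rw [← prob_compl_eq_zero_iff (MeasurableSet.measurableSet_limsup hsm)] at hlim
    exact compl_mem_ae_iff.2 hlim |> fun h => by simpa using h
  filter_upwards [hae] with x hx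
  obtain ⟨n, hn⟩ := (mem_limsup_iff_frequently_mem.1 hx).exists
  exact ⟨K + n.unpair.1, K + n.unpair.2, le_self_add, le_self_add, hn⟩

theorem exists_measure_le_abs_lt_half (γ : Measure ℝ) [IsFiniteMeasure γ] :
    ∃ m : ℕ, γ {t | √(2 ^ m) ≤ |t|} < 1 / 2 := by
  have hanti : Antitone fun m : ℕ => {t : ℝ | √(2 ^ m) ≤ |t|} := by
    intro m m' h t ht
    exact (Real.sqrt_le_sqrt (pow_le_pow_right₀ one_le_two h)).trans ht
  have hempty : ⋂ m : ℕ, {t : ℝ | √(2 ^ m) ≤ |t|} = ∅ := by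
    refine Set.eq_empty_of_forall_notMem fun t ht => ?_
    obtain ⟨m, hm⟩ := pow_unbounded_of_one_lt (|t| ^ 2) one_lt_two
    exact absurd (Set.mem_iInter.1 ht m) (not_le.2 ((Real.lt_sqrt (abs_nonneg t)).2 hm))
  have hlim := tendsto_measure_iInter_atTop (μ := γ)
    (fun m : ℕ => (measurableSet_le (measurable_const (a := √((2 : ℝ) ^ m)))
      (measurable_id' (α := ℝ)).abs).nullMeasurableSet) hanti ⟨0, measure_ne_top _ _⟩
  rw [hempty, measure_empty] at hlim
  exact (hlim.eventually_lt_const (by simp)).exists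

/-- For almost every configuration the exceptional corners spoil the limit theorem: they carry a
conditional probability at least `1/2` that the normalized sum lies in a closed set of small
Gaussian measure, along rectangles with both sides tending to infinity. -/
theorem not_quenchedCLT_signedSize :
    ¬ QuenchedCLT (knownEvents 0 0) fieldLaw fun i j => signedSize (i, j) := by
  intro hclt
  set γ := gaussianReal 0 (∫ x, signedSize (0, 0) x ^ 2 ∂fieldLaw).toNNReal with hγ
  obtain ⟨m, hm⟩ := exists_measure_le_abs_lt_half γ
  have hhalf : ∀ᵐ x ∂fieldLaw, ∀ i j : ℕ, 0 < i →
      √(2 ^ m) * √((i + 1 : ℕ) * (j + 1 : ℕ)) ≤ √(2 ^ x (Sum.inr ((i : ℤ), (j : ℤ)))) →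
      1 / 2 ≤ quenchedMeasure (knownEvents 0 0) fieldLaw x
        {y | √(2 ^ m) * √((i + 1 : ℕ) * (j + 1 : ℕ)) ≤
          |rectSum (fun i j => signedSize (i, j)) (i + 1) (j + 1) y|} := by
    simp_rw [ae_all_iff]
    exact fun i j hi => half_le_quenchedMeasure_rectSum hi _
  obtain ⟨x, hx, hxhalf, hxsize⟩ := (hclt.and (hhalf.and (ae_all_iff.2 fun K =>
    ae_exists_exceptional_size m K))).exists
  have hclosed : IsClosed {t : ℝ | √(2 ^ m) ≤ |t|} := isClosed_le continuous_const continuous_abs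
  have hlimsup := ProbabilityMeasure.limsup_measure_closed_le_of_tendsto hx.tendsto hclosed
  simp only [ProbabilityMeasure.coe_mk, Measure.map_id] at hlimsup
  have hev := eventually_lt_of_limsup_lt (hlimsup.trans_lt hm)
  obtain ⟨⟨n, v⟩, hnv⟩ := eventually_atTop.1 hev
  obtain ⟨i, j, hi, hj, hsize⟩ := hxsize (max (max n v) 1)
  have hlt := hnv (i + 1, j + 1) (Prod.mk_le_mk.2 ⟨by omega, by omega⟩)
  rw [Measure.map_apply ((measurable_rectSum _ _).div_const _) hclosed.measurableSet] at hlt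
  refine (hxhalf i j (by omega) ?_).not_gt (lt_of_eq_of_lt ?_ hlt)
  · rw [← Real.sqrt_mul (by positivity)]
    exact Real.sqrt_le_sqrt (by exact_mod_cast hsize)
  · congr 1
    ext y
    have hpos : 0 < √(((i + 1 : ℕ) : ℝ) * ((j + 1 : ℕ) : ℝ)) := Real.sqrt_pos.2 (by positivity)
    simp only [Set.mem_ofPred_eq, Set.mem_preimage, abs_div, abs_of_pos hpos, le_div_iff₀ hpos]

/-! ### The counterexample -/

theorem theorem2 :
    ∃ (Ω : Type) (mΩ : MeasurableSpace Ω) (_ : StandardBorelSpace Ω)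
      (P : Measure Ω) (_ : IsProbabilityMeasure P)
      (T S : Equiv.Perm Ω) (F₀ : MeasurableSpace Ω) (X₀ : Ω → ℝ),
      -- two commuting, invertible, bimeasurable, measure preserving and ergodic transformations
      Measurable[mΩ, mΩ] T.symm ∧ Measurable[mΩ, mΩ] S.symm ∧
      Ergodic T P ∧ Ergodic S P ∧ (∀ ω, T (S ω) = S (T ω)) ∧
      -- the filtration: sub-σ-fields, increasing in each index, commuting
      F₀ ≤ mΩ ∧
      F₀ ≤ shiftFiltration T S F₀ 0 1 ∧ F₀ ≤ shiftFiltration T S F₀ 1 0 ∧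
      IsCommutingFiltration P (shiftFiltration T S F₀) ∧
      -- the adapted, square integrable, orthomartingale difference field
      Measurable[F₀] X₀ ∧ MemLp X₀ 2 P ∧
      IsOrthomartingaleDifference P (shiftFiltration T S F₀) (shiftField T S X₀) ∧
      -- the moment conditions
      ∫⁻ ω, ENNReal.ofReal (X₀ ω ^ 2 * Real.log (1 + |X₀ ω|)) ∂P = ⊤ ∧
      (∀ ε : ℝ, 0 < ε → ε < 1 →
        ∫⁻ ω, ENNReal.ofReal (X₀ ω ^ 2 * Real.log (1 + |X₀ ω|) ^ (1 - ε)) ∂P < ⊤) ∧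
      -- the quenched central limit theorem fails
      ¬ QuenchedCLT F₀ P (shiftField T S X₀) := by
  have hfield : shiftField (configShift (.ofAdd (1, 0))) (configShift (.ofAdd (0, 1)))
      (signedSize (0, 0)) = fun i j => signedSize (i, j) :=
    funext fun i => funext fun j => shiftField_configShift i j
  refine ⟨Coord → ℕ, MeasurableSpace.pi, inferInstance, fieldLaw, inferInstance,
    configShift (.ofAdd (1, 0)), configShift (.ofAdd (0, 1)), knownEvents 0 0,
    signedSize (0, 0), measurable_configShift_symm _, measurable_configShift_symm _,
    ergodic_configShift (by simp), ergodic_configShift (by simp), fun x => ?_,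
    cylinderEvents_le_pi, ?_, ?_, ?_, ?_, memLp_signedSize _, ?_, ?_, ?_, ?_⟩
  · rw [← Equiv.Perm.mul_apply, ← Equiv.Perm.mul_apply, ← map_mul configShift,
      ← map_mul configShift, mul_comm]
  · rw [shiftFiltration_configShift]
    exact cylinderEvents_mono (knownCoords_mono le_rfl zero_le_one)
  · rw [shiftFiltration_configShift]
    exact cylinderEvents_mono (knownCoords_mono zero_le_one le_rfl)
  · classical
    intro Y hY a b u v
    simp only [shiftFiltration_configShift, knownEvents, ← knownCoords_inter]
    exact condExp_condExp_cylinderEvents coordLaw _ _ hY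
  · exact measurable_signedSize_of_mem (inl_mem_knownCoords.2 ⟨le_rfl, le_rfl⟩)
      (inr_mem_knownCoords _ _ _)
  · intro i j u v h
    rw [shiftFiltration_configShift, shiftField_configShift]
    exact condExp_signedSize_ae_eq_zero h
  · simp only [signedSize_sq, abs_signedSize]
    exact (lintegral_size (0, 0) fun k =>
      ENNReal.ofReal (2 ^ k * Real.log (1 + √(2 ^ k)))).trans lintegral_two_pow_mul_log_sizeLaw
  · intro ε hε hε1
    simp only [signedSize_sq, abs_signedSize]
    exact (lintegral_size (0, 0) fun k =>
      ENNReal.ofReal (2 ^ k * Real.log (1 + √(2 ^ k)) ^ (1 - ε))).trans_lt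
        (lintegral_two_pow_mul_log_rpow_sizeLaw_lt_top hε hε1)
  · rw [hfield]
    exact not_quenchedCLT_signedSize
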